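/- Let $F$ be a field of characteristic $2$. A \emph{totally singular quadratic form} over $F$ is a map $\varphi:V\to F$ on a finite-dimensional $F$-vector space $V$ such that $\varphi(xv)=x^2\varphi(v)$ and $\varphi(v+w)=\varphi(v)+\varphi(w)$ for all $x\in F$ and $v,w\in V$; put $\dim\varphi=\dim V$. It is \emph{anisotropic} if $\varphi(v)\neq0$ for all $v\neq0$. Write $\langle a_1,\dots,a_n\rangle$ for the form $x\mapsto\sum_i a_ix_i^2$ on $F^n$, $\perp$ for the orthogonal sum and $\simeq$ for isometry. Forms $\varphi,\psi$ are \emph{similar} if $\varphi\simeq c\psi$ for some $c\in F^*$, and $\sigma\subseteq\pi$ means that there is an injective linear map $f$ with $\pi(f(v))=\sigma(v)$ for all $v$. A \emph{quasi-Pfister form} is a form isometric to $\langle\langle a_1,\dots,a_n\rangle\rangle=\langle1,a_1\rangle\otimes\cdots\otimes\langle1,a_n\rangle$ with $n\geq0$ and $a_i\in F$ (which is $\langle1\rangle$ for $n=0$). A totally singular quadratic form $\varphi$ is a \emph{special quasi-Pfister neighbor} if it is similar to $\pi\perp b\sigma$ for a quasi-Pfister form $\pi$, some $b\in F^*$ and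 a form $\sigma\subseteq\pi$. For a field extension $E/F$, $\varphi_E$ is the totally singular quadratic form on $E\otimes_FV$ with $\varphi_E(e\otimes v)=e^2\varphi(v)$, and $(\varphi_E)_{\mathrm{an}}$ is its anisotropic part, i.e. the anisotropic form $\tau$ over $E$, unique up to isometry, such that $\varphi_E\simeq\tau\perp\langle0,\dots,0\rangle$ with some number $k\geq0$ of zeros. The \emph{full splitting pattern} of $\varphi$ is $\mathrm{fSP}(\varphi)=\{\dim(\varphi_E)_{\mathrm{an}} \mid E/F \text{ a field extension}\}$. Let $\varphi$ be an anisotropic special quasi-Pfister neighbor over $F$. 1. If $\dim\varphi=3$, then $\varphi$ is similar to $\langle\langle a\rangle\rangle\perp d\langle1\rangle$ for some $a,d\in F^*$, and $\mathrm{fSP}(\varphi)=\{1,2,3\}$. 2. If $\dim\varphi=5$, then $\varphi$ is similar to $\langle\langle a,b\rangle\rangle\perp d\langle1\rangle$ for some $a,b,d\in F^*$, and $\mathrm{fSP}(\varphi)=\{1,2,3,4,5\}$. 3. If $\dim\varphi=6$, then $\varphi$ is similar to $\langle\langle a,b\rangle\rangle\perp d\langle1,a\rangle$ for some $a,b,d\in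 F^*$, and $\mathrm{fSP}(\varphi)=\{1,2,3,4,6\}$. 4. If $\dim\varphi=7$, then $\varphi$ is similar to $\langle\langle a,b\rangle\rangle\perp d\langle1,a,b\rangle$ for some $a,b,d\in F^*$, and $\mathrm{fSP}(\varphi)=\{1,2,4,7\}$. 5. If $\dim\varphi=9$, then $\varphi$ is similar to $\langle\langle a,b,c\rangle\rangle\perp d\langle1\rangle$ for some $a,b,c,d\in F^*$, and $\mathrm{fSP}(\varphi)=\{1,2,3,4,5,8,9\}$. 6. If $\dim\varphi=10$, then $\varphi$ is similar to $\langle\langle a,b,c\rangle\rangle\perp d\langle1,a\rangle$ for some $a,b,c,d\in F^*$, and $\mathrm{fSP}(\varphi)=\{1,2,3,4,5,6,8,10\}$. 7. If $\dim\varphi=11$, then $\varphi$ is similar to $\langle\langle a,b,c\rangle\rangle\perp d\langle1,a,b\rangle$ for some $a,b,c,d\in F^*$, and $\mathrm{fSP}(\varphi)=\{1,2,3,4,6,7,8,11\}$. -/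

import Mathlib

open scoped TensorProduct

universe u v w

namespace TSQF

section Basic

variable {F : Type u} [Field F] {V : Type v} [AddCommGroup V] [Module F V]
  {W : Type w} [AddCommGroup W] [Module F W]

/-- A quadratic form is totally singular if it is additive (its polar form vanishes). -/
def IsTotallySingular (φ : QuadraticForm F V) : Prop :=
  ∀ x y : V, φ (x + y) = φ x + φ y

/-- The diagonal form `⟨a_i : i ∈ ι⟩`, i.e. `x ↦ ∑ i, a_i x_i²` on `F^ι`. -/
def diag {ι : Type*} [Fintype ι] (a : ι → F) : QuadraticForm F (ι → F) :=
  QuadraticMap.weightedSumSquares F a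

/-- The `n`-fold quasi-Pfister form `⟨⟨a_1, …, a_n⟩⟩ = ⟨1, a_1⟩ ⊗ ⋯ ⊗ ⟨1, a_n⟩`.  Multiplied out, this is
the diagonal form whose coefficients are the products `∏ i, a_i ^ e_i` with all `e_i ∈ {0, 1}`;
for `n = 0` it is `⟨1⟩`. -/
def pfister {n : ℕ} (a : Fin n → F) : QuadraticForm F ((Fin n → Fin 2) → F) :=
  diag (fun e : Fin n → Fin 2 => ∏ i, a i ^ (e i : ℕ))

/-- `σ ⊆ π`: there is an injective linear map `f` with `π (f x) = σ x` for all `x`. -/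
def IsSubform (σ : QuadraticForm F W) (π : QuadraticForm F V) : Prop :=
  ∃ f : QuadraticMap.Isometry σ π, Function.Injective f

/-- `φ` and `ψ` are similar: `φ ≃ c ψ` for some `c ≠ 0`. -/
def Similar (φ : QuadraticForm F V) (ψ : QuadraticForm F W) : Prop :=
  ∃ c : F, c ≠ 0 ∧ QuadraticMap.Equivalent φ (c • ψ)

/-- `φ` is totally singular and similar to `π ⊥ b σ`, where `π` is a quasi-Pfister form, `b ≠ 0`
and `σ ⊆ π`. Up to isometry, every totally singular form `σ` is some `⟨s_1, …, s_m⟩`. -/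
def IsSpecialQuasiPfisterNeighbor (φ : QuadraticForm F V) : Prop :=
  IsTotallySingular φ ∧
    ∃ (n : ℕ) (a : Fin n → F) (m : ℕ) (s : Fin m → F) (b : F), b ≠ 0 ∧
      IsSubform (diag s) (pfister a) ∧
      Similar φ (QuadraticMap.prod (pfister a) (b • diag s))

/-- `σ` is an anisotropic part of `φ`: it is anisotropic and `φ ≃ σ ⊥ k × ⟨0⟩` for some `k ≥ 0`. -/
def IsAnisotropicPart (σ : QuadraticForm F W) (φ : QuadraticForm F V) : Prop :=
  σ.Anisotropic ∧
    ∃ k : ℕ, QuadraticMap.Equivalent φ (QuadraticMap.prod σ (diag (fun _ : Fin k => (0 : F))))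

end Basic

section Extension

variable {F : Type u} [Field F] {V : Type v} [AddCommGroup V] [Module F V]

/-- The scalar extension `φ_E` on `E ⊗ V` of a quadratic form `φ`, in any characteristic: choose a
bilinear form `B`, not necessarily symmetric, with `φ x = B x x`; then `φ_E x = B_E x x`. The result
does not depend on `B`. For totally singular `φ` it is the only totally singular form with
`φ_E (e ⊗ v) = e² φ v`, as the three facts below show. -/
noncomputable def extend (E : Type w) [Field E] [Algebra F E] (φ : QuadraticForm F V) :
    QuadraticForm E (E ⊗[F] V) :=
  LinearMap.BilinMap.toQuadraticMap
    (LinearMap.BilinForm.baseChange E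
      (LinearMap.BilinMap.toQuadraticMap_surjective (R := F) (M := V) (N := F) φ).choose)

theorem extend_tmul (E : Type w) [Field E] [Algebra F E] (φ : QuadraticForm F V) (e : E) (v : V) :
    extend E φ (e ⊗ₜ[F] v) = e ^ 2 * algebraMap F E (φ v) := by
  have h := (LinearMap.BilinMap.toQuadraticMap_surjective (R := F) (M := V) (N := F) φ).choose_spec
  have h2 := congrArg (fun q : QuadraticForm F V => q v) h
  simp only [LinearMap.BilinMap.toQuadraticMap_apply] at h2
  simp only [extend, LinearMap.BilinMap.toQuadraticMap_apply,
    LinearMap.BilinForm.baseChange_tmul, h2, Algebra.smul_def]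
  ring

theorem isTotallySingular_extend (E : Type w) [Field E] [Algebra F E] (φ : QuadraticForm F V)
    (hφ : IsTotallySingular φ) : IsTotallySingular (extend E φ) := by
  have h := (LinearMap.BilinMap.toQuadraticMap_surjective (R := F) (M := V) (N := F) φ).choose_spec
  unfold extend
  set B := (LinearMap.BilinMap.toQuadraticMap_surjective (R := F) (M := V) (N := F) φ).choose
  have hB : ∀ x y, B x y + B y x = 0 := by
    intro x y
    have := hφ x y
    rw [← h] at this
    simp only [LinearMap.BilinMap.toQuadraticMap_apply, map_add, LinearMap.add_apply] at this
    linear_combination this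
  have hE : ∀ x y, LinearMap.BilinForm.baseChange E B x y
      + LinearMap.BilinForm.baseChange E B y x = 0 := by
    intro x y
    induction x using TensorProduct.induction_on with
    | zero => simp
    | add x₁ x₂ h₁ h₂ =>
      simp only [map_add, LinearMap.add_apply]
      linear_combination h₁ + h₂
    | tmul e v =>
      induction y using TensorProduct.induction_on with
      | zero => simp
      | add y₁ y₂ h₁ h₂ =>
        simp only [map_add, LinearMap.add_apply]
        linear_combination h₁ + h₂
      | tmul e' v' =>
        simp only [LinearMap.BilinForm.baseChange_tmul]
        rw [mul_comm e' e, ← add_smul, hB, zero_smul]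
  intro x y
  simp only [LinearMap.BilinMap.toQuadraticMap_apply, map_add, LinearMap.add_apply]
  linear_combination hE x y

theorem eq_extend_of_tmul (E : Type w) [Field E] [Algebra F E] (φ : QuadraticForm F V)
    (hφ : IsTotallySingular φ) (ψ : QuadraticForm E (E ⊗[F] V)) (hψ : IsTotallySingular ψ)
    (h : ∀ (e : E) (v : V), ψ (e ⊗ₜ[F] v) = e ^ 2 * algebraMap F E (φ v)) : ψ = extend E φ := by
  refine QuadraticMap.ext fun x => ?_
  induction x using TensorProduct.induction_on with
  | zero => simp
  | tmul e v => rw [h, extend_tmul]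
  | add x y hx hy => rw [hψ, isTotallySingular_extend E φ hφ, hx, hy]

/-- The full splitting pattern `{dim (φ_E)_an | E/F a field extension}`; the anisotropic part of `φ_E`
is written as a diagonal form `⟨s_1, …, s_n⟩` over `E`, so that its dimension is `n`. -/
def fullSplittingPattern (φ : QuadraticForm F V) : Set ℕ :=
  {n : ℕ | ∃ (E : Type u) (_ : Field E) (_ : Algebra F E) (s : Fin n → E),
    IsAnisotropicPart (diag s) (extend E φ)}

end Extension

end TSQF

/-! In characteristic 2 squaring is additive and injective, so over an algebraically closed field
`Ω` containing `F` a totally singular form `φ` is the square of a unique `F`-linear map `f : V → Ω`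
(`IsSqrtMap`). Everything is read off the subspace `f(V)`: for anisotropic `φ` it determines the
isometry class (`equivalent_of_range_eq`), and for a field `E` between `F` and `Ω` the dimension of
`(φ_E)_an` is the `E`-dimension of the `E`-span of `f(V)`
(`IsSqrtMap.exists_isAnisotropicPart_extend_iff`).

A quasi-Pfister form has as image the field `L` generated by the square roots of its slots. A
special neighbor therefore has image `γ(L + δM)` with `M ⊆ L` a subspace. Absorbing an element of
`M` into `δ` gives `1 ∈ M`. If `dim M ≤ 3`, the other basis elements of `M` start a minimal
generating family of `L`, which yields the normal forms.

Over `E`, each of the roots `x_0, …, x_{n-1}`, `x_n = δ` either lies in the field generated over `E`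
by its predecessors or doubles its degree. These alternatives, a Boolean vector `p`, determine the
dimension (`patternDim`), since `L_E ∩ δ M_E = 0` when `δ ∉ L_E`, while `δ M_E ⊆ L_E` otherwise.
Every `p` occurs: anisotropy makes the roots 2-independent, and one adjoins to `F` those `x_i` with
`p i` true (`mem_adjoin_adjoin_iff`). The splitting patterns are then finite enumerations. -/

namespace TSQF

/-! ### Linear square roots of totally singular forms -/

section SquareRoots

variable {F : Type*} [Field F] {Ω : Type*} [Field Ω] [Algebra F Ω]
  {V : Type*} [AddCommGroup V] [Module F V] {W : Type*} [AddCommGroup W] [Module F W]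

/-- `f` is a linear square root of the form `φ` with values in the extension field `Ω`. -/
def IsSqrtMap (f : V →ₗ[F] Ω) (φ : QuadraticForm F V) : Prop :=
  ∀ v, f v ^ 2 = algebraMap F Ω (φ v)

theorem IsSqrtMap.eq_zero_iff {f : V →ₗ[F] Ω} {φ : QuadraticForm F V} (hf : IsSqrtMap f φ) (v : V) :
    f v = 0 ↔ φ v = 0 := by
  have h := hf v
  constructor
  · intro h0
    rw [h0] at h
    simpa using h.symm
  · intro h0
    rw [h0] at h
    simpa using h

theorem IsSqrtMap.injective {f : V →ₗ[F] Ω} {φ : QuadraticForm F V} (hf : IsSqrtMap f φ)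
    (hφ : φ.Anisotropic) : Function.Injective f :=
  (injective_iff_map_eq_zero f).2 fun v hv => hφ v ((hf.eq_zero_iff v).1 hv)

theorem IsSqrtMap.comp {f : V →ₗ[F] Ω} {φ : QuadraticForm F V} (hf : IsSqrtMap f φ)
    {g : W →ₗ[F] V} {ψ : QuadraticForm F W} (hg : ∀ w, φ (g w) = ψ w) : IsSqrtMap (f ∘ₗ g) ψ :=
  fun w => by rw [LinearMap.comp_apply, hf, hg]

theorem IsSqrtMap.smul {f : V →ₗ[F] Ω} {φ : QuadraticForm F V} (hf : IsSqrtMap f φ)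
    {c : F} {γ : Ω} (hγ : γ ^ 2 = algebraMap F Ω c) :
    IsSqrtMap (LinearMap.mulLeft F γ ∘ₗ f) (c • φ) := fun v => by
  rw [LinearMap.comp_apply, LinearMap.mulLeft_apply, mul_pow, hf, hγ, smul_apply,
    smul_eq_mul, map_mul]

theorem IsSqrtMap.exists_of_equivalent {f : V →ₗ[F] Ω} {φ : QuadraticForm F V}
    (hf : IsSqrtMap f φ) {ψ : QuadraticForm F W} (h : QuadraticMap.Equivalent ψ φ) :
    ∃ g : W →ₗ[F] Ω, IsSqrtMap g ψ ∧ LinearMap.range g = LinearMap.range f := by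
  obtain ⟨e⟩ := h
  refine ⟨f ∘ₗ (e.toLinearEquiv : W →ₗ[F] V), hf.comp fun w => e.map_app w, ?_⟩
  exact LinearMap.range_comp_of_range_eq_top _ e.toLinearEquiv.range

theorem equivalent_of_range_eq {f : V →ₗ[F] Ω} {φ : QuadraticForm F V} (hf : IsSqrtMap f φ)
    {g : W →ₗ[F] Ω} {ψ : QuadraticForm F W} (hg : IsSqrtMap g ψ) (hfi : Function.Injective f)
    (hgi : Function.Injective g) (h : LinearMap.range f = LinearMap.range g) :
    QuadraticMap.Equivalent φ ψ := by
  let e : V ≃ₗ[F] W := (LinearEquiv.ofInjective f hfi).trans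
    ((LinearEquiv.ofEq _ _ h).trans (LinearEquiv.ofInjective g hgi).symm)
  have he : ∀ v, g (e v) = f v := fun v => by
    have h1 : LinearEquiv.ofInjective g hgi (e v)
        = LinearEquiv.ofEq _ _ h (LinearEquiv.ofInjective f hfi v) := by simp [e]
    simpa using congrArg Subtype.val h1
  refine ⟨{ e with map_app' := fun v => ?_ }⟩
  apply (algebraMap F Ω).injective
  rw [← hf v, ← hg]
  exact congrArg (· ^ 2) (he v)

/-- The zero summands die under the square root map, and the anisotropic summand embeds, so the
image sees exactly the anisotropic part. -/
theorem IsSqrtMap.finrank_of_isAnisotropicPart {f : V →ₗ[F] Ω} {φ : QuadraticForm F V}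
    (hf : IsSqrtMap f φ) {n : ℕ} {s : Fin n → F} (h : IsAnisotropicPart (diag s) φ) :
    Module.finrank F (LinearMap.range f) = n := by
  obtain ⟨hs, k, ⟨e⟩⟩ := h
  obtain ⟨g, hg, hgf⟩ := hf.exists_of_equivalent ⟨e.symm⟩
  have h0 : ∀ y, g (0, y) = 0 := fun y => by
    rw [hg.eq_zero_iff, QuadraticMap.prod_apply]
    simp [diag, QuadraticMap.weightedSumSquares_apply]
  have hl : IsSqrtMap (g ∘ₗ LinearMap.inl F _ _) (diag s) := hg.comp fun w => by
    rw [QuadraticMap.prod_apply]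
    simp
  have hr : LinearMap.range (g ∘ₗ LinearMap.inl F _ _) = LinearMap.range g := by
    refine le_antisymm (LinearMap.range_comp_le_range _ _) ?_
    rintro _ ⟨⟨x, y⟩, rfl⟩
    refine ⟨x, ?_⟩
    have : ((x, y) : (Fin n → F) × (Fin k → F)) = (x, 0) + (0, y) := by simp
    rw [this, map_add, h0, add_zero]
    rfl
  rw [← hgf, ← hr, LinearMap.finrank_range_of_inj (hl.injective hs)]
  simp

variable [CharP Ω 2]

theorem IsSqrtMap.unique {f g : V →ₗ[F] Ω} {φ : QuadraticForm F V} (hf : IsSqrtMap f φ)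
    (hg : IsSqrtMap g φ) : f = g := by
  ext v
  have h : (f v - g v) ^ 2 = 0 := by
    rw [CharTwo.sub_eq_add, CharTwo.add_sq, hf, hg, CharTwo.add_self_eq_zero]
  exact sub_eq_zero.1 (pow_eq_zero_iff two_ne_zero |>.1 h)

theorem isSqrtMap_diag {ι : Type*} [Fintype ι] {s : ι → F} {τ : ι → Ω}
    (h : ∀ i, τ i ^ 2 = algebraMap F Ω (s i)) :
    IsSqrtMap (Fintype.linearCombination F τ) (diag s) := fun x => by
  rw [Fintype.linearCombination_apply, CharTwo.sum_sq, diag, QuadraticMap.weightedSumSquares_apply,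
    map_sum]
  refine Finset.sum_congr rfl fun i _ => ?_
  rw [Algebra.smul_def, mul_pow, h, smul_eq_mul, map_mul, map_mul]
  ring

theorem IsSqrtMap.prod {f : V →ₗ[F] Ω} {φ : QuadraticForm F V} (hf : IsSqrtMap f φ)
    {g : W →ₗ[F] Ω} {ψ : QuadraticForm F W} (hg : IsSqrtMap g ψ) :
    IsSqrtMap (f.coprod g) (QuadraticMap.prod φ ψ) := fun v => by
  rw [LinearMap.coprod_apply, CharTwo.add_sq, hf, hg, QuadraticMap.prod_apply, map_add]

end SquareRoots

/-! ### Anisotropic parts over extensions as spans in `Ω` -/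

section AnisotropicPart

variable {F : Type*} [Field F] {E : Type*} [Field E] [Algebra F E] {Ω : Type*} [Field Ω]
  [Algebra F Ω] [Algebra E Ω] [IsScalarTower F E Ω] [CharP Ω 2]
  {V : Type*} [AddCommGroup V] [Module F V]

theorem IsSqrtMap.liftBaseChange {f : V →ₗ[F] Ω} {φ : QuadraticForm F V} (hf : IsSqrtMap f φ)
    (hφ : IsTotallySingular φ) : IsSqrtMap (f.liftBaseChange E) (extend E φ) := fun x => by
  induction x using TensorProduct.induction_on with
  | zero => simp
  | tmul e v =>
    rw [LinearMap.liftBaseChange_tmul, extend_tmul, Algebra.smul_def, mul_pow, hf, map_mul, map_pow,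
      IsScalarTower.algebraMap_apply F E Ω]
  | add x y hx hy =>
    rw [map_add, CharTwo.add_sq, hx, hy, isTotallySingular_extend E φ hφ, map_add]

/-- The kernel of `f` is the zero set of `φ`. On a complement `f` is injective, so `φ` is
anisotropic there, and a basis of the complement diagonalizes it. -/
theorem IsSqrtMap.exists_isAnisotropicPart [FiniteDimensional F V] {f : V →ₗ[F] Ω}
    {φ : QuadraticForm F V} (hf : IsSqrtMap f φ) :
    ∃ s : Fin (Module.finrank F (LinearMap.range f)) → F, IsAnisotropicPart (diag s) φ := by
  obtain ⟨q, hq⟩ := Submodule.exists_isCompl (LinearMap.ker f)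
  have hn : Module.finrank F q = Module.finrank F (LinearMap.range f) :=
    (LinearMap.kerComplementEquivRange f hq.symm).finrank_eq
  let b := Module.finBasisOfFinrankEq F q hn
  let c := Module.finBasis F (LinearMap.ker f)
  have hτ : ∀ i, f (b i) ^ 2 = algebraMap F Ω (φ (b i)) := fun i => hf _
  have hD := isSqrtMap_diag hτ
  have hb : ∀ x, Fintype.linearCombination F (fun i => f (b i)) x = f (b.equivFun.symm x) := by
    intro x
    simp [Fintype.linearCombination_apply, Module.Basis.equivFun_symm_apply]
  refine ⟨fun i => φ (b i), ?_, Module.finrank F (LinearMap.ker f), ?_⟩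
  · intro x hx
    have h1 := (hD.eq_zero_iff x).2 hx
    rw [hb] at h1
    have h2 := (Submodule.disjoint_def.1 hq.disjoint) _ (LinearMap.mem_ker.2 h1)
      (b.equivFun.symm x).2
    exact b.equivFun.symm.map_eq_zero_iff.1 (Subtype.ext h2)
  · let e : ((Fin (Module.finrank F (LinearMap.range f)) → F) ×
        (Fin (Module.finrank F (LinearMap.ker f)) → F)) ≃ₗ[F] V :=
      (LinearEquiv.prodCongr b.equivFun.symm c.equivFun.symm).trans
        (Submodule.prodEquivOfIsCompl q (LinearMap.ker f) hq.symm)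
    refine QuadraticMap.Equivalent.symm ⟨{ e with map_app' := fun x => ?_ }⟩
    apply (algebraMap F Ω).injective
    change algebraMap F Ω (φ (e x)) = _
    have h1 : f (e x) = f (b.equivFun.symm x.1) := by
      have h2 : e x = (b.equivFun.symm x.1 : V) + (c.equivFun.symm x.2 : V) := rfl
      rw [h2, map_add, LinearMap.mem_ker.1 (c.equivFun.symm x.2).2, add_zero]
    rw [← hf, h1, ← hb, hD, QuadraticMap.prod_apply]
    congr 1
    simp [diag, QuadraticMap.weightedSumSquares_apply]

theorem IsSqrtMap.exists_isAnisotropicPart_extend_iff [FiniteDimensional F V] {f : V →ₗ[F] Ω}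
    {φ : QuadraticForm F V} (hf : IsSqrtMap f φ) (hφ : IsTotallySingular φ) {n : ℕ} :
    (∃ s : Fin n → E, IsAnisotropicPart (diag s) (extend E φ)) ↔
      Module.finrank E (Submodule.span E (LinearMap.range f : Set Ω)) = n := by
  have hE : IsSqrtMap (f.liftBaseChange E) (extend E φ) := hf.liftBaseChange hφ
  rw [← LinearMap.range_liftBaseChange]
  constructor
  · rintro ⟨s, hs⟩
    exact hE.finrank_of_isAnisotropicPart hs
  · rintro rfl
    exact hE.exists_isAnisotropicPart

end AnisotropicPart

open IntermediateField

/-! ### Fields generated by square roots -/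

section SquareRootExtensions

variable {E : Type*} [Field E] {Ω : Type*} [Field Ω] [Algebra E Ω]

theorem isIntegral_of_sq_mem {x : Ω} (hx : ∃ a, algebraMap E Ω a = x ^ 2) : IsIntegral E x := by
  obtain ⟨a, ha⟩ := hx
  refine IsIntegral.of_pow two_pos ?_
  rw [← ha]
  exact isIntegral_algebraMap

/-- This is why the image of a quasi-Pfister form is a field: the span of the squarefree monomials
is stable under each `x i`, and the generators are algebraic, so the field they generate is the
algebra they generate. -/
theorem span_monomials_eq_adjoin {n : ℕ} (x : Fin n → Ω)
    (hx : ∀ i, ∃ a, algebraMap E Ω a = x i ^ 2) :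
    Submodule.span E (Set.range fun e : Fin n → Fin 2 => ∏ i, x i ^ (e i : ℕ)) =
      Subalgebra.toSubmodule (adjoin E (Set.range x)).toSubalgebra := by
  set S := Submodule.span E (Set.range fun e : Fin n → Fin 2 => ∏ i, x i ^ (e i : ℕ)) with hS
  apply le_antisymm
  · rw [hS, Submodule.span_le]
    rintro _ ⟨e, rfl⟩
    exact IntermediateField.prod_mem _ fun i _ =>
      pow_mem (subset_adjoin E _ (Set.mem_range_self i)) _
  · have hmul : ∀ i, ∀ z ∈ S, x i * z ∈ S := by
      intro i z hz
      induction hz using Submodule.span_induction with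
      | zero => simp
      | add y z _ _ hy hz => rw [mul_add]; exact S.add_mem hy hz
      | smul a y _ hy => rw [mul_smul_comm]; exact S.smul_mem a hy
      | mem y hy =>
        obtain ⟨e, rfl⟩ := hy
        have hsplit : ∀ e' : Fin n → Fin 2, ∏ j, x j ^ (e' j : ℕ) =
            x i ^ (e' i : ℕ) * ∏ j ∈ Finset.univ.erase i, x j ^ (e' j : ℕ) := fun e' =>
          (Finset.mul_prod_erase _ _ (Finset.mem_univ i)).symm
        have hupd : ∀ t : Fin 2, ∏ j, x j ^ (Function.update e i t j : ℕ) =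
            x i ^ (t : ℕ) * ∏ j ∈ Finset.univ.erase i, x j ^ (e j : ℕ) := by
          intro t
          rw [hsplit, Function.update_self]
          congr 1
          refine Finset.prod_congr rfl fun j hj => ?_
          rw [Function.update_of_ne (Finset.ne_of_mem_erase hj)]
        -- Multiplication by `x i` raises exponent 0 to 1; exponent 1 drops to 0 with the scalar `x
        -- i ^ 2 ∈ E` split off.
        rcases Fin.exists_fin_two.1 ⟨e i, rfl⟩ with h | h
        · refine Submodule.subset_span ⟨Function.update e i 1, ?_⟩
          simp only [hupd]
          rw [hsplit e, h]
          simp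
        · obtain ⟨a, ha⟩ := hx i
          have hm : a • ∏ j, x j ^ (Function.update e i 0 j : ℕ) ∈ S :=
            S.smul_mem a (Submodule.subset_span ⟨Function.update e i 0, rfl⟩)
          convert hm using 1
          simp only
          rw [hupd, hsplit e, h, Algebra.smul_def, ha]
          simp
          ring
    have h1 : (1 : Ω) ∈ S := Submodule.subset_span ⟨0, by simp⟩
    intro y hy
    rw [adjoin_toSubalgebra_of_isAlgebraic] at hy
    · have key : ∀ z ∈ S, y * z ∈ S := by
        refine Algebra.adjoin_induction (p := fun y _ => ∀ z ∈ S, y * z ∈ S) ?_ ?_ ?_ ?_ hy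
        · rintro _ ⟨i, rfl⟩
          exact hmul i
        · intro r z hz
          rw [← Algebra.smul_def]
          exact S.smul_mem r hz
        · intro a b _ _ ha hb z hz
          rw [add_mul]
          exact S.add_mem (ha z hz) (hb z hz)
        · intro a b _ _ ha hb z hz
          rw [mul_assoc]
          exact ha _ (hb z hz)
      simpa using key 1 h1
    · rintro _ ⟨i, rfl⟩
      exact (isIntegral_of_sq_mem (hx i)).isAlgebraic

theorem finrank_adjoin_simple_of_sq_mem {x : Ω} (hx : ∃ a, algebraMap E Ω a = x ^ 2)
    (h : x ∉ (⊥ : IntermediateField E Ω)) : Module.finrank E (adjoin E {x}) = 2 := by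
  have hint := isIntegral_of_sq_mem hx
  obtain ⟨a, ha⟩ := hx
  have h1 : Module.finrank E (adjoin E {x}) ≠ 1 := fun h' =>
    h (finrank_adjoin_simple_eq_one_iff.1 h')
  have h0 : 0 < (minpoly E x).natDegree := minpoly.natDegree_pos hint
  have h2 : (minpoly E x).natDegree ≤ 2 := by
    have hd : (minpoly E x) ∣ Polynomial.X ^ 2 - Polynomial.C a :=
      minpoly.dvd E x (by simp [ha])
    have := Polynomial.natDegree_le_of_dvd hd (Polynomial.X_pow_sub_C_ne_zero two_pos a)
    rwa [Polynomial.natDegree_X_pow_sub_C] at this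
  rw [adjoin.finrank hint] at h1 ⊢
  omega

open Classical in
theorem finrank_adjoin_insert (S : Set Ω) {x : Ω} (hx : ∃ a, algebraMap E Ω a = x ^ 2) :
    Module.finrank E (adjoin E (insert x S)) =
      Module.finrank E (adjoin E S) * if x ∈ adjoin E S then 1 else 2 := by
  split_ifs with h
  · have : adjoin E (insert x S) = adjoin E S := by
      apply le_antisymm
      · rw [adjoin_le_iff, Set.insert_subset_iff]
        exact ⟨h, subset_adjoin E S⟩
      · exact adjoin.mono _ _ _ (Set.subset_insert _ _)
    rw [this, mul_one]
  · have h2 : Module.finrank (adjoin E S) (adjoin (adjoin E S) {x}) = 2 := by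
      apply finrank_adjoin_simple_of_sq_mem
      · obtain ⟨a, ha⟩ := hx
        exact ⟨algebraMap E _ a, ha⟩
      · rw [mem_bot]
        rintro ⟨y, rfl⟩
        exact h y.2
    have h3 : adjoin E (insert x S) = (adjoin (adjoin E S) {x}).restrictScalars E := by
      rw [adjoin_adjoin_left, Set.union_singleton]
    rw [h3, ← h2]
    exact (Module.finrank_mul_finrank E (adjoin E S) (adjoin (adjoin E S) {x})).symm

theorem finiteDimensional_adjoin_of_sq_mem {ι : Type*} [Finite ι] (x : ι → Ω)
    (hx : ∀ i, ∃ a, algebraMap E Ω a = x i ^ 2) (S : Set ι) :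
    FiniteDimensional E (adjoin E (x '' S)) := by
  have : Finite (x '' S) := (Set.toFinite S).image x
  refine finiteDimensional_adjoin ?_
  rintro _ ⟨i, _, rfl⟩
  exact isIntegral_of_sq_mem (hx i)

theorem finrank_adjoin_image_le {ι : Type*} (x : ι → Ω)
    (hx : ∀ i, ∃ a, algebraMap E Ω a = x i ^ 2) (S : Finset ι) :
    Module.finrank E (adjoin E (x '' (S : Set ι))) ≤ 2 ^ S.card := by
  classical
  induction S using Finset.induction_on with
  | empty =>
    rw [Finset.coe_empty, Set.image_empty, adjoin_empty, IntermediateField.finrank_bot, Finset.card_empty,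
      pow_zero]
  | insert i S hi ih =>
    rw [Finset.coe_insert, Set.image_insert_eq, finrank_adjoin_insert _ (hx i),
      Finset.card_insert_of_notMem hi, pow_succ]
    refine Nat.mul_le_mul ih ?_
    split_ifs <;> norm_num

theorem finrank_adjoin_image_lt {r : ℕ} (x : Fin r → Ω)
    (hx : ∀ i, ∃ a, algebraMap E Ω a = x i ^ 2) {p : Fin r → Bool}
    (hp : ∀ i, p i = true ↔ x i ∈ adjoin E (x '' Set.Iio i)) (k : ℕ) :
    Module.finrank E (adjoin E (x '' {i | i.val < k})) =
      ∏ i : Fin r, if i.val < k then (if p i then 1 else 2) else 1 := by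
  induction k with
  | zero => simp
  | succ k ih =>
    by_cases hk : k < r
    · have hS : {i : Fin r | i.val < k + 1} = insert ⟨k, hk⟩ {i : Fin r | i.val < k} := by
        ext i
        simp [Fin.ext_iff]
        omega
      have hI : Set.Iio (⟨k, hk⟩ : Fin r) = {i : Fin r | i.val < k} := by
        ext i
        simp [Fin.lt_def]
      rw [hS, Set.image_insert_eq, finrank_adjoin_insert _ (hx _), ih,
        ← Finset.mul_prod_erase _ _ (Finset.mem_univ (⟨k, hk⟩ : Fin r)),
        ← Finset.mul_prod_erase _ _ (Finset.mem_univ (⟨k, hk⟩ : Fin r))]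
      have he : ∏ i ∈ Finset.univ.erase (⟨k, hk⟩ : Fin r),
          (if i.val < k + 1 then (if p i then 1 else 2) else 1) =
          ∏ i ∈ Finset.univ.erase (⟨k, hk⟩ : Fin r),
          (if i.val < k then (if p i then 1 else 2) else 1) := by
        refine Finset.prod_congr rfl fun i hi => ?_
        have : i.val ≠ k := fun h => Finset.ne_of_mem_erase hi (Fin.ext h)
        have : i.val < k + 1 ↔ i.val < k := by omega
        simp only [this]
      rw [he]
      have := hp ⟨k, hk⟩
      rw [hI] at this
      simp only [lt_irrefl, if_false, lt_add_one, if_true, one_mul, this]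
      rw [mul_comm]
      congr 2
      exact propext this.symm
    · have hS : {i : Fin r | i.val < k + 1} = {i : Fin r | i.val < k} := by
        ext i
        simp
        omega
      rw [hS, ih]
      refine Finset.prod_congr rfl fun i hi => ?_
      have : i.val < k + 1 ↔ i.val < k := by omega
      simp only [this]

/-- Adjoining some of the members of a `2`-independent family leaves the others `2`-independent. -/
theorem mem_adjoin_adjoin_iff {r : ℕ} (x : Fin r → Ω)
    (hx : ∀ i, ∃ a, algebraMap E Ω a = x i ^ 2)
    (hind : ∀ i, x i ∉ adjoin E (x '' Set.Iio i)) (T : Set (Fin r)) (i : Fin r) :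
    x i ∈ adjoin (adjoin E (x '' T)) (x '' Set.Iio i) ↔ i ∈ T := by
  classical
  rw [← mem_restrictScalars (K := E), adjoin_adjoin_left, ← Set.image_union]
  constructor
  · intro h
    by_contra hi
    -- If `i ∉ T`, then `x i` lies in the field generated by all the other roots. The whole field
    -- then has degree at most `2 ^ (r - 1)`, whereas independence gives `2 ^ r`.
    have h1 : x i ∈ adjoin E (x '' ((Finset.univ.erase i : Finset (Fin r)) : Set (Fin r))) := by
      refine adjoin.mono _ _ _ (Set.image_mono ?_) h
      rintro j (hj | hj)
      · simp only [Finset.coe_erase, Finset.coe_univ, Set.mem_sdiff, Set.mem_univ, true_and,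
          Set.mem_singleton_iff]
        rintro rfl
        exact hi hj
      · simpa using ne_of_lt hj
    have h2 := finrank_adjoin_image_lt x hx (p := fun _ => false) (fun i => by simpa using hind i) r
    have h3 : {i : Fin r | i.val < r} =
        insert i ((Finset.univ.erase i : Finset (Fin r)) : Set (Fin r)) := by
      ext j
      simp
    rw [h3, Set.image_insert_eq, finrank_adjoin_insert _ (hx i), if_pos h1] at h2
    have h4 := finrank_adjoin_image_le x hx (Finset.univ.erase i)
    rw [Finset.card_erase_of_mem (Finset.mem_univ i), Finset.card_univ, Fintype.card_fin] at h4
    simp only [Fin.is_lt, if_true, Bool.false_eq_true, if_false, Finset.prod_const, mul_one,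
      Finset.card_univ, Fintype.card_fin] at h2
    have : 2 ^ (r - 1) < 2 ^ r := Nat.pow_lt_pow_right one_lt_two (by have := i.pos; omega)
    omega
  · intro h
    exact subset_adjoin _ _ (Set.mem_image_of_mem x (Or.inl h))

theorem finrank_map_mulLeft (M : Submodule E Ω) {x : Ω} (hx : x ≠ 0) :
    Module.finrank E (M.map (LinearMap.mulLeft E x)) = Module.finrank E M :=
  (Submodule.equivMapOfInjective _ (mul_right_injective₀ hx) M).finrank_eq.symm

open Classical in
-- If `x y ∈ K` with `0 ≠ y ∈ M ⊆ K`, then `x = x y / y ∈ K`. Thus `x M` is either contained in `K`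
-- or meets it trivially.
theorem finrank_sup_map_mulLeft (K : IntermediateField E Ω) [FiniteDimensional E K]
    (M : Submodule E Ω) (hM : M ≤ Subalgebra.toSubmodule K.toSubalgebra) (x : Ω) :
    Module.finrank E ↥(Subalgebra.toSubmodule K.toSubalgebra ⊔ M.map (LinearMap.mulLeft E x)) =
      Module.finrank E K + if x ∈ K then 0 else Module.finrank E M := by
  have hK : FiniteDimensional E (Subalgebra.toSubmodule K.toSubalgebra) :=
    inferInstanceAs (FiniteDimensional E K)
  split_ifs with h
  · rw [sup_eq_left.2]
    · rfl
    · rintro _ ⟨y, hy, rfl⟩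
      exact K.mul_mem h (hM hy)
  · have hMf : FiniteDimensional E M := Submodule.finiteDimensional_of_le hM
    have hx : x ≠ 0 := fun h0 => h (h0 ▸ K.zero_mem)
    have hinf : Subalgebra.toSubmodule K.toSubalgebra ⊓ M.map (LinearMap.mulLeft E x) = ⊥ := by
      rw [eq_bot_iff]
      rintro _ ⟨hz, y, hy, rfl⟩
      by_contra h0
      have hy0 : y ≠ 0 := by
        rintro rfl
        simp at h0
      refine h ?_
      have : x * y / y ∈ K := K.div_mem hz (hM hy)
      rwa [mul_div_cancel_right₀ _ hy0] at this
    have := Submodule.finrank_sup_add_finrank_inf_eq (Subalgebra.toSubmodule K.toSubalgebra)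
      (M.map (LinearMap.mulLeft E x))
    rw [hinf, finrank_bot, add_zero, finrank_map_mulLeft _ hx] at this
    exact this

end SquareRootExtensions

/-! ### Images of forms `c (π ⊥ d σ)` -/

section NormalForm

variable {F : Type*} [Field F] {Ω : Type*} [Field Ω] [Algebra F Ω]
  {V : Type*} [AddCommGroup V] [Module F V] {W : Type*} [AddCommGroup W] [Module F W]

theorem injective_of_range_eq_of_finrank_eq [FiniteDimensional F V] [FiniteDimensional F W]
    {f : V →ₗ[F] Ω} {g : W →ₗ[F] Ω} (hf : Function.Injective f)
    (h : LinearMap.range f = LinearMap.range g) (hd : Module.finrank F V = Module.finrank F W) :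
    Function.Injective g := by
  rw [← LinearMap.ker_eq_bot, ← Submodule.finrank_eq_zero]
  have h1 := LinearMap.finrank_range_of_inj hf
  have h2 := LinearMap.finrank_range_add_finrank_ker g
  rw [← h] at h2
  omega

/-- Each element of `L` outside the field reached so far doubles the degree, so exactly `k` further
generators are needed. -/
theorem exists_adjoin_union_range_eq (L : IntermediateField F Ω) [FiniteDimensional F L]
    (hL : ∀ y ∈ L, ∃ a, algebraMap F Ω a = y ^ 2) (k : ℕ) (S : Set Ω) (hS : S ⊆ L)
    (h : Module.finrank F (adjoin F S) * 2 ^ k = Module.finrank F L) :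
    ∃ y : Fin k → Ω, adjoin F (S ∪ Set.range y) = L := by
  induction k generalizing S with
  | zero =>
    refine ⟨Fin.elim0, ?_⟩
    rw [Set.range_eq_empty, Set.union_empty]
    refine eq_of_le_of_finrank_eq (adjoin_le_iff.2 hS) ?_
    simpa using h
  | succ k ih =>
    have hlt : adjoin F S < L := by
      refine lt_of_le_of_ne (adjoin_le_iff.2 hS) fun h' => ?_
      rw [h'] at h
      have h0 : 0 < Module.finrank F L := Module.finrank_pos
      have h1 : 1 < 2 ^ (k + 1) := Nat.one_lt_two_pow (Nat.succ_ne_zero k)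
      have := Nat.mul_lt_mul_of_pos_left h1 h0
      omega
    obtain ⟨z, hzL, hz⟩ := SetLike.exists_of_lt hlt
    obtain ⟨y, hy⟩ := ih (insert z S) (Set.insert_subset hzL hS) (by
      rw [finrank_adjoin_insert S (hL z hzL), if_neg hz, ← h, pow_succ]
      ring)
    refine ⟨Fin.cons z y, ?_⟩
    rw [← hy, Fin.range_cons, Set.insert_union, Set.union_insert]

variable [CharP Ω 2]

theorem exists_sqrtMap_normalForm {n m : ℕ} {a : Fin n → F} {s : Fin m → F} {c d : F}
    {α : Fin n → Ω} {τ : Fin m → Ω} {γ δ : Ω} (hα : ∀ i, α i ^ 2 = algebraMap F Ω (a i))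
    (hτ : ∀ j, τ j ^ 2 = algebraMap F Ω (s j)) (hγ : γ ^ 2 = algebraMap F Ω c)
    (hδ : δ ^ 2 = algebraMap F Ω d) :
    ∃ g : ((Fin n → Fin 2) → F) × (Fin m → F) →ₗ[F] Ω,
      IsSqrtMap g (c • QuadraticMap.prod (pfister a) (d • diag s)) ∧
      LinearMap.range g = Submodule.map (LinearMap.mulLeft F γ)
        (Subalgebra.toSubmodule (adjoin F (Set.range α)).toSubalgebra ⊔
          Submodule.map (LinearMap.mulLeft F δ) (Submodule.span F (Set.range τ))) := by
  have hp : IsSqrtMap (Fintype.linearCombination F fun e : Fin n → Fin 2 => ∏ i, α i ^ (e i : ℕ))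
      (pfister a) := isSqrtMap_diag fun e => by
    rw [map_prod, ← Finset.prod_pow]
    refine Finset.prod_congr rfl fun i _ => ?_
    rw [← pow_mul, mul_comm, pow_mul, hα, map_pow]
  refine ⟨_, (hp.prod ((isSqrtMap_diag hτ).smul hδ)).smul hγ, ?_⟩
  rw [LinearMap.range_comp, LinearMap.range_coprod, LinearMap.range_comp,
    Fintype.range_linearCombination, Fintype.range_linearCombination,
    span_monomials_eq_adjoin α fun i => ⟨a i, (hα i).symm⟩]

theorem similar_normalForm [FiniteDimensional F V] {φ : QuadraticForm F V} {f : V →ₗ[F] Ω}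
    (hf : IsSqrtMap f φ) (hφ : φ.Anisotropic) {n m : ℕ}
    {a : Fin n → F} {s : Fin m → F} {c d : F} (hc : c ≠ 0)
    {α : Fin n → Ω} {τ : Fin m → Ω} {γ δ : Ω} (hα : ∀ i, α i ^ 2 = algebraMap F Ω (a i))
    (hτ : ∀ j, τ j ^ 2 = algebraMap F Ω (s j)) (hγ : γ ^ 2 = algebraMap F Ω c)
    (hδ : δ ^ 2 = algebraMap F Ω d) (hd : Module.finrank F V = 2 ^ n + m)
    (hr : LinearMap.range f = Submodule.map (LinearMap.mulLeft F γ)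
        (Subalgebra.toSubmodule (adjoin F (Set.range α)).toSubalgebra ⊔
          Submodule.map (LinearMap.mulLeft F δ) (Submodule.span F (Set.range τ)))) :
    Similar φ (QuadraticMap.prod (pfister a) (d • diag s)) := by
  obtain ⟨g, hg, hgr⟩ := exists_sqrtMap_normalForm hα hτ hγ hδ
  rw [← hgr] at hr
  have hfi := hf.injective hφ
  exact ⟨c, hc, equivalent_of_range_eq hf hg hfi
    (injective_of_range_eq_of_finrank_eq hfi hr (by simp [hd])) hr⟩

theorem exists_algebraMap_eq_sq_of_mem_adjoin {n : ℕ} {α : Fin n → Ω}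
    (hα : ∀ i, ∃ a, algebraMap F Ω a = α i ^ 2) {y : Ω} (hy : y ∈ adjoin F (Set.range α)) :
    ∃ a, algebraMap F Ω a = y ^ 2 := by
  choose a ha using hα
  have hy' : y ∈ Subalgebra.toSubmodule (adjoin F (Set.range α)).toSubalgebra := hy
  have hp := isSqrtMap_diag (F := F) (Ω := Ω) (ι := Fin n → Fin 2)
    (s := fun e => ∏ i, a i ^ (e i : ℕ)) (τ := fun e => ∏ i, α i ^ (e i : ℕ)) fun e => by
      rw [map_prod, ← Finset.prod_pow]
      refine Finset.prod_congr rfl fun i _ => ?_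
      rw [← pow_mul, mul_comm, pow_mul, ← ha, map_pow]
  rw [← span_monomials_eq_adjoin α fun i => ⟨a i, ha i⟩, ← Fintype.range_linearCombination] at hy'
  obtain ⟨z, rfl⟩ := hy'
  exact ⟨_, (hp z).symm⟩

theorem IsSpecialQuasiPfisterNeighbor.exists_range_eq [FiniteDimensional F V] [IsAlgClosed Ω]
    {φ : QuadraticForm F V} (hφ : φ.Anisotropic) (hs : IsSpecialQuasiPfisterNeighbor φ) :
    ∃ (n m : ℕ) (L : IntermediateField F Ω) (M : Submodule F Ω) (c b : F) (γ δ : Ω)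
      (f : V →ₗ[F] Ω), Module.finrank F V = 2 ^ n + m ∧ m ≤ 2 ^ n ∧ FiniteDimensional F L ∧
      Module.finrank F L = 2 ^ n ∧ Module.finrank F M = m ∧
      M ≤ Subalgebra.toSubmodule L.toSubalgebra ∧ (∀ y ∈ L, ∃ a, algebraMap F Ω a = y ^ 2) ∧
      c ≠ 0 ∧ γ ^ 2 = algebraMap F Ω c ∧ δ ^ 2 = algebraMap F Ω b ∧ IsSqrtMap f φ ∧
      LinearMap.range f = Submodule.map (LinearMap.mulLeft F γ)
        (Subalgebra.toSubmodule L.toSubalgebra ⊔ Submodule.map (LinearMap.mulLeft F δ) M) := by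
  obtain ⟨-, n, a, m, s, b, hb, ⟨j, hj⟩, c, hc, e⟩ := hs
  have hsq : ∀ t : F, ∃ z : Ω, z ^ 2 = algebraMap F Ω t := fun t =>
    IsAlgClosed.exists_pow_nat_eq _ two_pos
  choose r hr using hsq
  have hα : ∀ i, r (a i) ^ 2 = algebraMap F Ω (a i) := fun i => hr _
  have hτ : ∀ i, r (s i) ^ 2 = algebraMap F Ω (s i) := fun i => hr _
  have hα' : ∀ i, ∃ t, algebraMap F Ω t = r (a i) ^ 2 := fun i => ⟨_, (hr _).symm⟩
  obtain ⟨g, hg, hgr⟩ := exists_sqrtMap_normalForm hα hτ (hr c) (hr b)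
  obtain ⟨f, hf, hfg⟩ := hg.exists_of_equivalent e
  have hfi := hf.injective hφ
  obtain ⟨e⟩ := e
  have hdim : Module.finrank F V = 2 ^ n + m := by
    rw [e.toLinearEquiv.finrank_eq]
    simp
  have hgi : Function.Injective g :=
    injective_of_range_eq_of_finrank_eq hfi hfg e.toLinearEquiv.finrank_eq
  have hga : (c • QuadraticMap.prod (pfister a) (b • diag s)).Anisotropic := fun x hx =>
    hgi (((hg.eq_zero_iff x).2 hx).trans (map_zero g).symm)
  have hpa : (pfister a).Anisotropic := fun x hx => by
    have := hga (x, 0) (by simp [QuadraticMap.prod_apply, hx])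
    exact (Prod.mk.inj this).1
  have hsa : (diag s).Anisotropic := fun x hx => by
    have := hga (0, x) (by simp [QuadraticMap.prod_apply, hx])
    exact (Prod.mk.inj this).2
  -- The case of an empty `σ` supplies the square root map of the quasi-Pfister form alone.
  obtain ⟨p, hp, hpr⟩ := exists_sqrtMap_normalForm (m := 0) (s := Fin.elim0) (τ := Fin.elim0)
    (c := 1) (γ := (1 : Ω)) (d := 0) (δ := 0) hα (fun i => i.elim0) (by simp) (by simp)
  have hp1 : IsSqrtMap (p ∘ₗ LinearMap.inl F _ _) (pfister a) := hp.comp fun w => by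
    simp [QuadraticMap.prod_apply]
  have hp2 : LinearMap.range (p ∘ₗ LinearMap.inl F _ _) =
      Subalgebra.toSubmodule (adjoin F (Set.range fun i => r (a i))).toSubalgebra := by
    have h1 : LinearMap.range (p ∘ₗ LinearMap.inl F _ _) = LinearMap.range p := by
      refine le_antisymm (LinearMap.range_comp_le_range _ _) ?_
      rintro _ ⟨⟨x, y⟩, rfl⟩
      exact ⟨x, by rw [Subsingleton.elim y 0]; rfl⟩
    rw [h1, hpr, Set.range_eq_empty (Fin.elim0 : Fin 0 → Ω), Submodule.span_empty,
      Submodule.map_bot, sup_bot_eq, LinearMap.mulLeft_one, Submodule.map_id]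
  have hfd : FiniteDimensional F (adjoin F (Set.range fun i => r (a i))) := by
    rw [← Set.image_univ]
    exact finiteDimensional_adjoin_of_sq_mem _ hα' _
  refine ⟨n, m, adjoin F (Set.range fun i => r (a i)), Submodule.span F (Set.range fun i => r (s i)),
    c, b, r c, r b, f, hdim, ?_, hfd, ?_, ?_, ?_, ?_, hc, hr c, hr b, hf, hfg.trans hgr⟩
  · have := LinearMap.finrank_le_finrank_of_injective (f := j.toLinearMap) hj
    simpa using this
  · have := LinearMap.finrank_range_of_inj (hp1.injective hpa)
    rw [hp2] at this
    simpa using this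
  · have := LinearMap.finrank_range_of_inj ((isSqrtMap_diag hτ).injective hsa)
    rw [Fintype.range_linearCombination] at this
    simpa using this
  · have h1 : IsSqrtMap ((p ∘ₗ LinearMap.inl F _ _) ∘ₗ j.toLinearMap) (diag s) :=
      hp1.comp fun w => j.map_app w
    -- By uniqueness, the square root map of `σ` factors through the embedding `σ ⊆ π`; hence its
    -- image lies in the field attached to `π`.
    rw [← Fintype.range_linearCombination, (isSqrtMap_diag hτ).unique h1, ← hp2]
    exact LinearMap.range_comp_le_range _ _
  · exact fun y hy => exists_algebraMap_eq_sq_of_mem_adjoin hα' hy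

/-- A vanishing slot or a vanishing `d` would give a basis vector on which the form is zero; `m + 1`
ensures that `σ` has such a vector. -/
theorem coeff_ne_zero_of_similar {φ : QuadraticForm F V} (hφ : φ.Anisotropic) {n m : ℕ}
    {a : Fin n → F} {s : Fin (m + 1) → F} {d : F}
    (h : Similar φ (QuadraticMap.prod (pfister a) (d • diag s))) : (∀ i, a i ≠ 0) ∧ d ≠ 0 := by
  classical
  obtain ⟨c, -, ⟨e⟩⟩ := h
  have hga : (c • QuadraticMap.prod (pfister a) (d • diag s)).Anisotropic := fun x hx => by
    have h1 := hφ (e.symm x) (by rw [QuadraticMap.IsometryEquiv.map_app, hx])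
    have h2 := congrArg e h1
    simpa using h2
  constructor
  · intro i hi
    have := hga (Pi.single (Pi.single i 1) 1, 0) (by
      have : ∏ k, a k ^ ((Pi.single i 1 : Fin n → Fin 2) k : ℕ) = 0 :=
        Finset.prod_eq_zero (Finset.mem_univ i) (by simp [hi])
      rw [smul_apply, QuadraticMap.prod_apply, pfister, diag,
        QuadraticMap.weightedSumSquares_apply, Finset.sum_eq_single (Pi.single i 1)]
      · simp [this]
      · intro e _ he
        simp [Pi.single_eq_of_ne he]
      · simp)
    have h2 := congrFun (Prod.mk.inj this).1 (Pi.single i 1)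
    simp at h2
  · rintro rfl
    have := hga (0, Pi.single 0 1) (by simp [QuadraticMap.prod_apply])
    have h2 := congrFun (Prod.mk.inj this).2 0
    simp at h2

end NormalForm

/-! ### Normal forms of special neighbors for `dim σ ≤ 3` -/

theorem span_pair_eq_adjoin {E : Type*} [Field E] {Ω : Type*} [Field Ω] [Algebra E Ω] {x : Ω}
    (hx : ∃ a, algebraMap E Ω a = x ^ 2) :
    Submodule.span E {1, x} = Subalgebra.toSubmodule (adjoin E {x}).toSubalgebra := by
  have h := span_monomials_eq_adjoin (E := E) ![x] (by simpa using hx)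
  have h1 : (Set.range fun e : Fin 1 → Fin 2 => ∏ i, (![x] : Fin 1 → Ω) i ^ (e i : ℕ)) = {1, x} := by
    ext y
    simp only [Set.mem_range, Finset.univ_unique, Fin.default_eq_zero, Finset.prod_singleton,
      Matrix.cons_val_zero, Set.mem_insert_iff, Set.mem_singleton_iff]
    constructor
    · rintro ⟨e, rfl⟩
      rcases Fin.exists_fin_two.1 ⟨e 0, rfl⟩ with h | h <;> simp [h]
    · rintro (rfl | rfl)
      · exact ⟨fun _ => 0, by simp⟩
      · exact ⟨fun _ => 1, by simp⟩
  rwa [h1, Matrix.range_cons, Matrix.range_empty, Set.union_empty] at h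

section Classification

variable {F : Type*} [Field F] [CharP F 2] {V : Type*} [AddCommGroup V] [Module F V]
  [FiniteDimensional F V] {φ : QuadraticForm F V}

/-- Dividing a basis of `M` by its first member `β 0` and replacing `δ` by `δ * β 0` leaves `δ M`
unchanged and puts 1 into the basis. Any `n` square roots generating `L` may then serve as slots,
which leaves the choice of generators free. -/
theorem IsSpecialQuasiPfisterNeighbor.exists_similar (hφ : φ.Anisotropic)
    (hs : IsSpecialQuasiPfisterNeighbor φ) (Ω : Type*) [Field Ω] [Algebra F Ω] [IsAlgClosed Ω]
    (n m : ℕ)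
    (hnm : ∀ k l, Module.finrank F V = 2 ^ k + l → l ≤ 2 ^ k → k = n ∧ l = m + 1) :
    ∃ (L : IntermediateField F Ω) (τ : Fin (m + 1) → Ω) (d : F), FiniteDimensional F L ∧
      Module.finrank F L = 2 ^ n ∧ (∀ y ∈ L, ∃ a, algebraMap F Ω a = y ^ 2) ∧ τ 0 = 1 ∧
      LinearIndependent F τ ∧ (∀ j, τ j ∈ L) ∧
      ∀ (α : Fin n → Ω) (a : Fin n → F) (s : Fin (m + 1) → F), adjoin F (Set.range α) = L →
        (∀ i, α i ^ 2 = algebraMap F Ω (a i)) → (∀ j, τ j ^ 2 = algebraMap F Ω (s j)) →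
        Similar φ (QuadraticMap.prod (pfister a) (d • diag s)) := by
  have : CharP Ω 2 := charP_of_injective_algebraMap (algebraMap F Ω).injective 2
  obtain ⟨k, l, L, M, c, b, γ, δ, f, hd, hl, hL, hLd, hMd, hM, hsq, hc, hγ, hδ, hf, hr⟩ :=
    hs.exists_range_eq (Ω := Ω) hφ
  obtain ⟨rfl, rfl⟩ := hnm k l hd hl
  have : FiniteDimensional F M := FiniteDimensional.of_finrank_pos (by omega)
  let β := Module.finBasisOfFinrankEq F M hMd
  have hx : (β 0 : Ω) ≠ 0 := fun h => β.ne_zero 0 (Subtype.ext h)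
  have hβL : ∀ j, (β j : Ω) ∈ L := fun j => hM (β j).2
  obtain ⟨t, ht⟩ := hsq _ (hβL 0)
  have hspan : Submodule.map (LinearMap.mulLeft F (β 0 : Ω))
      (Submodule.span F (Set.range fun j => (β j : Ω) / β 0)) = M := by
    rw [Submodule.map_span, ← Set.range_comp]
    have h1 : (LinearMap.mulLeft F (β 0 : Ω) ∘ fun j => (β j : Ω) / β 0) = M.subtype ∘ β :=
      funext fun j => mul_div_cancel₀ _ hx
    rw [h1, Set.range_comp, ← Submodule.map_span, β.span_eq, Submodule.map_top,
      Submodule.range_subtype]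
  refine ⟨L, fun j => β j / β 0, b * t, hL, hLd, hsq, div_self hx, ?_,
    fun j => L.div_mem (hβL j) (hβL 0), ?_⟩
  · have h1 : LinearIndependent F (M.subtype ∘ β) :=
      β.linearIndependent.map' _ M.ker_subtype
    refine LinearIndependent.of_comp (LinearMap.mulLeft F (β 0 : Ω)) ?_
    have h2 : (LinearMap.mulLeft F (β 0 : Ω) ∘ fun j => (β j : Ω) / β 0) = M.subtype ∘ β :=
      funext fun j => mul_div_cancel₀ _ hx
    rwa [h2]
  · intro α a s hα ha hs'
    refine similar_normalForm hf hφ hc ha hs' hγ (δ := δ * β 0) ?_ hd ?_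
    · rw [mul_pow, hδ, map_mul, ht]
    · rw [hr, hα, LinearMap.mulLeft_mul, Submodule.map_comp, hspan]

theorem IsSpecialQuasiPfisterNeighbor.exists_similar_one (hφ : φ.Anisotropic)
    (hs : IsSpecialQuasiPfisterNeighbor φ) (n : ℕ)
    (hn : ∀ k l, Module.finrank F V = 2 ^ k + l → l ≤ 2 ^ k → k = n ∧ l = 1) :
    ∃ (a : Fin n → F) (d : F), Similar φ (QuadraticMap.prod (pfister a) (d • diag ![(1 : F)])) := by
  obtain ⟨L, τ, d, hL, hLd, hsq, h0, hli, hτ, h⟩ :=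
    hs.exists_similar hφ (AlgebraicClosure F) n 0 hn
  obtain ⟨y, hy⟩ := exists_adjoin_union_range_eq L hsq n ∅ (Set.empty_subset _) (by
    rw [adjoin_empty, IntermediateField.finrank_bot, hLd, one_mul])
  have hyL : ∀ i, y i ∈ L := fun i => hy ▸ subset_adjoin F _ (Or.inr (Set.mem_range_self i))
  choose a ha using fun i => hsq _ (hyL i)
  refine ⟨a, d, h y a _ (by rw [← hy, Set.empty_union]) (fun i => (ha i).symm) fun j => ?_⟩
  rw [show j = 0 from Fin.fin_one_eq_zero j, h0]
  simp

theorem IsSpecialQuasiPfisterNeighbor.exists_similar_two (hφ : φ.Anisotropic)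
    (hs : IsSpecialQuasiPfisterNeighbor φ) (n : ℕ)
    (hn : ∀ k l, Module.finrank F V = 2 ^ k + l → l ≤ 2 ^ k → k = n + 1 ∧ l = 2) :
    ∃ (a : Fin (n + 1) → F) (d : F),
      Similar φ (QuadraticMap.prod (pfister a) (d • diag ![1, a 0])) := by
  obtain ⟨L, τ, d, hL, hLd, hsq, h0, hli, hτ, h⟩ :=
    hs.exists_similar hφ (AlgebraicClosure F) (n + 1) 1 hn
  have h1 : τ 1 ∉ (⊥ : IntermediateField F (AlgebraicClosure F)) := by
    intro h1
    obtain ⟨r, hr⟩ := mem_bot.1 h1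
    refine hli.notMem_span_image (s := {0}) (x := 1) (by simp) ?_
    rw [Set.image_singleton, h0, Submodule.mem_span_singleton]
    exact ⟨r, by rw [← hr, Algebra.smul_def, mul_one]⟩
  obtain ⟨y, hy⟩ := exists_adjoin_union_range_eq L hsq n (insert (τ 1) ∅)
    (Set.insert_subset (hτ 1) (Set.empty_subset _)) (by
      rw [finrank_adjoin_insert _ (hsq _ (hτ 1)), adjoin_empty, if_neg h1,
        IntermediateField.finrank_bot, hLd, pow_succ]
      ring)
  have hzL : ∀ i, (Fin.cons (τ 1) y : Fin (n + 1) → AlgebraicClosure F) i ∈ L := fun i => by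
    refine Fin.cases (hτ 1) (fun i => ?_) i
    exact hy ▸ subset_adjoin F _ (Or.inr (Set.mem_range_self i))
  choose a ha using fun i => hsq _ (hzL i)
  refine ⟨a, d, h (Fin.cons (τ 1) y) a _ ?_ (fun i => (ha i).symm) fun j => ?_⟩
  · rw [← hy, Fin.range_cons, Set.insert_union, Set.empty_union]
  · refine Fin.cases ?_ (fun j => ?_) j
    · simp [h0]
    · rw [Subsingleton.elim j 0]
      exact (ha 0).symm

theorem IsSpecialQuasiPfisterNeighbor.exists_similar_three (hφ : φ.Anisotropic)
    (hs : IsSpecialQuasiPfisterNeighbor φ) (n : ℕ)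
    (hn : ∀ k l, Module.finrank F V = 2 ^ k + l → l ≤ 2 ^ k → k = n + 2 ∧ l = 3) :
    ∃ (a : Fin (n + 2) → F) (d : F),
      Similar φ (QuadraticMap.prod (pfister a) (d • diag ![1, a 0, a 1])) := by
  obtain ⟨L, τ, d, hL, hLd, hsq, h0, hli, hτ, h⟩ :=
    hs.exists_similar hφ (AlgebraicClosure F) (n + 2) 2 hn
  have h1 : τ 1 ∉ (⊥ : IntermediateField F (AlgebraicClosure F)) := by
    intro h1
    obtain ⟨r, hr⟩ := mem_bot.1 h1
    refine hli.notMem_span_image (s := {0}) (x := 1) (by simp) ?_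
    rw [Set.image_singleton, h0, Submodule.mem_span_singleton]
    exact ⟨r, by rw [← hr, Algebra.smul_def, mul_one]⟩
  -- As `F(τ 1)` is the span of `1` and `τ 1`, linear independence is what makes `τ 2` double the
  -- degree again.
  have h2 : τ 2 ∉ adjoin F {τ 1} := by
    intro h2
    refine hli.notMem_span_image (s := {0, 1}) (x := 2) (by simp [Fin.ext_iff]) ?_
    rw [Set.image_pair, h0, span_pair_eq_adjoin (hsq _ (hτ 1))]
    exact h2
  rw [← insert_empty_eq (τ 1)] at h2
  obtain ⟨y, hy⟩ := exists_adjoin_union_range_eq L hsq n (insert (τ 2) (insert (τ 1) ∅))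
    (Set.insert_subset (hτ 2) (Set.insert_subset (hτ 1) (Set.empty_subset _))) (by
      rw [finrank_adjoin_insert _ (hsq _ (hτ 2)), if_neg h2,
        finrank_adjoin_insert _ (hsq _ (hτ 1)), adjoin_empty, if_neg h1,
        IntermediateField.finrank_bot, hLd, pow_add]
      ring)
  have hzL : ∀ i, (Fin.cons (τ 1) (Fin.cons (τ 2) y : Fin (n + 1) → AlgebraicClosure F) :
      Fin (n + 2) → AlgebraicClosure F) i ∈ L := fun i => by
    refine Fin.cases (hτ 1) (fun i => Fin.cases (hτ 2) (fun i => ?_) i) i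
    exact hy ▸ subset_adjoin F _ (Or.inr (Set.mem_range_self i))
  choose a ha using fun i => hsq _ (hzL i)
  refine ⟨a, d, h _ a _ ?_ (fun i => (ha i).symm) fun j => ?_⟩
  · rw [← hy, Fin.range_cons, Fin.range_cons, Set.insert_union, Set.insert_union, Set.empty_union,
      Set.insert_comm]
  · refine Fin.cases ?_ (fun j => Fin.cases ?_ (fun j => ?_) j) j
    · simp [h0]
    · exact (ha 0).symm
    · rw [Subsingleton.elim j 0]
      exact (ha 1).symm

end Classification

/-! ### The full splitting pattern as the range of `patternDim` -/

section SplittingPattern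

theorem span_map_mulLeft {F : Type*} [Field F] (E : Type*) [Field E] [Algebra F E] {Ω : Type*}
    [Field Ω] [Algebra F Ω] [Algebra E Ω] [IsScalarTower F E Ω] (x : Ω) (M : Submodule F Ω) :
    Submodule.span E (M.map (LinearMap.mulLeft F x) : Set Ω) =
      (Submodule.span E (M : Set Ω)).map (LinearMap.mulLeft E x) := by
  rw [Submodule.map_span]
  rfl

theorem span_sup_tower {F : Type*} [Field F] (E : Type*) [Field E] [Algebra F E] {Ω : Type*}
    [Field Ω] [Algebra F Ω] [Algebra E Ω] [IsScalarTower F E Ω] (M N : Submodule F Ω) :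
    Submodule.span E ((M ⊔ N : Submodule F Ω) : Set Ω) =
      Submodule.span E (M : Set Ω) ⊔ Submodule.span E (N : Set Ω) := by
  apply le_antisymm
  · rw [Submodule.span_le]
    intro z hz
    obtain ⟨x, hx, y, hy, rfl⟩ := Submodule.mem_sup.1 hz
    exact add_mem (Submodule.mem_sup_left (Submodule.subset_span hx))
      (Submodule.mem_sup_right (Submodule.subset_span hy))
  · exact sup_le (Submodule.span_mono fun _ h => Submodule.mem_sup_left h)
      (Submodule.span_mono fun _ h => Submodule.mem_sup_right h)

variable {F : Type u} [Field F] {V : Type v} [AddCommGroup V] [Module F V]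

/-- The possible dimensions of `K + δ S`, where `K` is generated by square roots `x_0, …, x_{n-1}`,
`δ = x_n`, and `S ⊆ K` has dimension `σ p`; here `p i` says whether `x_i` lies in the field generated
by its predecessors. -/
def patternDim {n : ℕ} (σ : (Fin (n + 1) → Bool) → ℕ) (p : Fin (n + 1) → Bool) : ℕ :=
  (∏ i : Fin n, if p i.castSucc then 1 else 2) + if p (Fin.last n) then 0 else σ p

/-- `σ` computes the dimension of the span of the monomials in square roots with exponents `t`. -/
def ComputesSpanDim {n m : ℕ} (t : Fin m → Fin n → Fin 2) (σ : (Fin (n + 1) → Bool) → ℕ) : Prop :=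
  ∀ (E Ω : Type u) [Field E] [Field Ω] [Algebra E Ω] (x : Fin (n + 1) → Ω),
    (∀ i, ∃ a, algebraMap E Ω a = x i ^ 2) → ∀ p : Fin (n + 1) → Bool,
    (∀ i, p i = true ↔ x i ∈ adjoin E (x '' Set.Iio i)) →
    Module.finrank E (Submodule.span E
      (Set.range fun j => ∏ i, x i.castSucc ^ (t j i : ℕ))) = σ p

theorem finrank_span_range_eq_patternDim {n m : ℕ} {t : Fin m → Fin n → Fin 2}
    {σ : (Fin (n + 1) → Bool) → ℕ} (hσ : ComputesSpanDim.{u} t σ) {E Ω : Type u} [Field E] [Field Ω]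
    [Algebra F E] [Algebra F Ω] [Algebra E Ω] [IsScalarTower F E Ω] {x : Fin (n + 1) → Ω} {γ : Ω}
    (hγ : γ ≠ 0) (hx : ∀ i, ∃ a, algebraMap F Ω a = x i ^ 2) {p : Fin (n + 1) → Bool}
    (hp : ∀ i, p i = true ↔ x i ∈ adjoin E (x '' Set.Iio i)) {f : V →ₗ[F] Ω}
    (hf : LinearMap.range f = Submodule.map (LinearMap.mulLeft F γ)
        (Subalgebra.toSubmodule (adjoin F (Set.range fun i : Fin n => x i.castSucc)).toSubalgebra ⊔
          Submodule.map (LinearMap.mulLeft F (x (Fin.last n))) (Submodule.span F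
            (Set.range fun j => ∏ i, x i.castSucc ^ (t j i : ℕ))))) :
    Module.finrank E (Submodule.span E (LinearMap.range f : Set Ω)) = patternDim σ p := by
  have hxE : ∀ i, ∃ a, algebraMap E Ω a = x i ^ 2 := fun i => by
    obtain ⟨a, ha⟩ := hx i
    exact ⟨algebraMap F E a, by rw [← IsScalarTower.algebraMap_apply, ha]⟩
  have hI : Set.range (fun i : Fin n => x i.castSucc) = x '' {i | i.val < n} := by
    ext y
    constructor
    · rintro ⟨i, rfl⟩
      exact ⟨_, i.2, rfl⟩
    · rintro ⟨i, hi, rfl⟩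
      exact ⟨⟨i, hi⟩, rfl⟩
  have hl : Set.Iio (Fin.last n) = {i : Fin (n + 1) | i.val < n} := by
    ext i
    simp [Fin.lt_def]
  rw [hf, span_map_mulLeft, finrank_map_mulLeft _ hγ, span_sup_tower, span_map_mulLeft,
    ← span_monomials_eq_adjoin _ (fun i => hx _), Submodule.span_span_of_tower,
    Submodule.span_span_of_tower, span_monomials_eq_adjoin _ (fun i => hxE _)]
  have hfd := finiteDimensional_adjoin_of_sq_mem x hxE {i | i.val < n}
  rw [← hI] at hfd
  rw [finrank_sup_map_mulLeft, hσ E Ω x hxE p hp, patternDim]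
  · congr 1
    · rw [hI, finrank_adjoin_image_lt x hxE hp, Fin.prod_univ_castSucc]
      simp
    · rw [hI, ← hl]
      simp only [← hp (Fin.last n)]
  · rw [Submodule.span_le]
    rintro _ ⟨j, rfl⟩
    exact IntermediateField.prod_mem _ fun i _ =>
      pow_mem (subset_adjoin E _ (Set.mem_range_self i)) _

variable [CharP F 2] [FiniteDimensional F V] {φ : QuadraticForm F V}

/-- The hypothesis `hmax` says that the full dimension occurs only when no root is redundant; with
anisotropy it gives 2-independence over `F`. -/
theorem fullSplittingPattern_eq_range {n m : ℕ} {t : Fin m → Fin n → Fin 2}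
    {σ : (Fin (n + 1) → Bool) → ℕ} (hσ : ComputesSpanDim.{u} t σ) (hφ : φ.Anisotropic)
    (hts : IsTotallySingular φ) (A : Fin (n + 1) → F)
    (hs : Similar φ (QuadraticMap.prod (pfister fun i : Fin n => A i.castSucc)
      (A (Fin.last n) • diag fun j => ∏ i : Fin n, A i.castSucc ^ (t j i : ℕ))))
    (hmax : ∀ p, patternDim σ p = Module.finrank F V → ∀ i, p i = false) :
    fullSplittingPattern φ = Set.range (patternDim σ) := by
  classical
  obtain ⟨c, hc, e⟩ := hs
  -- `Ω` stays variable: one inclusion needs the algebraic closure of the given `E`, the other that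
  -- of `F`.
  have key : ∀ (Ω : Type u) [Field Ω] [Algebra F Ω] [IsAlgClosed Ω], ∃ (x : Fin (n + 1) → Ω)
      (f : V →ₗ[F] Ω), (∀ i, ∃ a, algebraMap F Ω a = x i ^ 2) ∧ IsSqrtMap f φ ∧
      ∀ (E : Type u) [Field E] [Algebra F E] [Algebra E Ω] [IsScalarTower F E Ω]
        (p : Fin (n + 1) → Bool), (∀ i, p i = true ↔ x i ∈ adjoin E (x '' Set.Iio i)) →
        Module.finrank E (Submodule.span E (LinearMap.range f : Set Ω)) = patternDim σ p := by
    intro Ω _ _ _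
    have : CharP Ω 2 := charP_of_injective_algebraMap (algebraMap F Ω).injective 2
    have hsq : ∀ t : F, ∃ z : Ω, z ^ 2 = algebraMap F Ω t := fun t =>
      IsAlgClosed.exists_pow_nat_eq _ two_pos
    choose r hr using hsq
    have hx : ∀ i, r (A i) ^ 2 = algebraMap F Ω (A i) := fun i => hr _
    obtain ⟨g, hg, hgr⟩ := exists_sqrtMap_normalForm (fun i : Fin n => hx i.castSucc)
      (τ := fun j : Fin m => ∏ i : Fin n, r (A i.castSucc) ^ (t j i : ℕ))
      (s := fun j => ∏ i : Fin n, A i.castSucc ^ (t j i : ℕ)) (fun j => by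
        rw [map_prod, ← Finset.prod_pow]
        refine Finset.prod_congr rfl fun i _ => ?_
        rw [← pow_mul, mul_comm, pow_mul, hx, map_pow]) (hr c) (hx (Fin.last n))
    obtain ⟨f, hf, hfg⟩ := hg.exists_of_equivalent e
    have hγ : r c ≠ 0 := fun h => by
      have := hr c
      rw [h, zero_pow two_ne_zero] at this
      exact hc ((map_eq_zero _).1 this.symm)
    refine ⟨fun i => r (A i), f, fun i => ⟨_, (hx i).symm⟩, hf, fun E _ _ _ _ p hp => ?_⟩
    exact finrank_span_range_eq_patternDim hσ hγ (fun i => ⟨_, (hx i).symm⟩) hp (hfg.trans hgr)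
  ext k
  constructor
  · rintro ⟨E, _, _, hk⟩
    obtain ⟨x, f, hx, hf, h⟩ := key (AlgebraicClosure E)
    have : CharP (AlgebraicClosure E) 2 :=
      charP_of_injective_algebraMap (algebraMap F (AlgebraicClosure E)).injective 2
    rw [hf.exists_isAnisotropicPart_extend_iff hts] at hk
    refine ⟨fun i => decide (x i ∈ adjoin E (x '' Set.Iio i)), ?_⟩
    rw [← hk, h E (fun i => decide (x i ∈ adjoin E (x '' Set.Iio i))) fun i => by simp]
  · rintro ⟨p, rfl⟩
    obtain ⟨x, f, hx, hf, h⟩ := key (AlgebraicClosure F)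
    have : CharP (AlgebraicClosure F) 2 :=
      charP_of_injective_algebraMap (algebraMap F (AlgebraicClosure F)).injective 2
    have hind : ∀ i, x i ∉ adjoin F (x '' Set.Iio i) := by
      have h1 := h F (fun i => decide (x i ∈ adjoin F (x '' Set.Iio i))) fun i => by simp
      rw [Submodule.span_eq, LinearMap.finrank_range_of_inj (hf.injective hφ)] at h1
      intro i
      simpa using hmax _ h1.symm i
    -- Adjoining exactly the roots marked by `p` realizes `p`, by 2-independence.
    refine ⟨adjoin F (x '' {i | p i = true}), inferInstance, inferInstance, ?_⟩
    rw [hf.exists_isAnisotropicPart_extend_iff hts]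
    exact h _ p fun i => (mem_adjoin_adjoin_iff x hx hind {i | p i = true} i).symm

end SplittingPattern

/-! ### The cases `σ = ⟨1⟩`, `⟨1, a⟩`, `⟨1, a, b⟩` -/

section SmallSubforms

theorem prod_pow_single {R : Type*} [CommMonoid R] {n : ℕ} (x : Fin n → R) (k : Fin n) :
    ∏ i, x i ^ ((Pi.single k 1 : Fin n → Fin 2) i : ℕ) = x k := by
  rw [Finset.prod_eq_single k]
  · simp
  · intro i _ hi
    simp [Pi.single_eq_of_ne hi]
  · simp

theorem finrank_adjoin_zero {E : Type*} [Field E] {Ω : Type*} [Field Ω] [Algebra E Ω] {n : ℕ}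
    {x : Fin (n + 1) → Ω} (hx : ∀ i, ∃ a, algebraMap E Ω a = x i ^ 2) {p : Fin (n + 1) → Bool}
    (hp : ∀ i, p i = true ↔ x i ∈ adjoin E (x '' Set.Iio i)) :
    Module.finrank E (adjoin E {x 0}) = if p 0 then 1 else 2 := by
  have h := finrank_adjoin_insert ∅ (hx 0)
  have h0 : Set.Iio (0 : Fin (n + 1)) = ∅ := by
    ext i
    simp
  have hp0 := hp 0
  rw [h0, Set.image_empty] at hp0
  rw [insert_empty_eq, adjoin_empty, IntermediateField.finrank_bot, one_mul] at h
  rw [h, ← adjoin_empty]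
  simp only [← hp0]

theorem computesSpanDim_one (n : ℕ) :
    ComputesSpanDim.{u} (![0] : Fin 1 → Fin n → Fin 2) fun _ => 1 := by
  intro E Ω _ _ _ x hx p hp
  have h : (Set.range fun j => ∏ i, x i.castSucc ^ ((![0] : Fin 1 → Fin n → Fin 2) j i : ℕ)) =
      {1} := by
    rw [Set.range_unique]
    simp
  rw [h, finrank_span_singleton one_ne_zero]

theorem computesSpanDim_two (n : ℕ) :
    ComputesSpanDim.{u} (![0, Pi.single 0 1] : Fin 2 → Fin (n + 1) → Fin 2)
      fun p => if p 0 then 1 else 2 := by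
  intro E Ω _ _ _ x hx p hp
  have h : (Set.range fun j => ∏ i, x i.castSucc ^
      ((![0, Pi.single 0 1] : Fin 2 → Fin (n + 1) → Fin 2) j i : ℕ)) = {1, x 0} := by
    ext y
    simp [Fin.exists_fin_two, prod_pow_single fun i : Fin (n + 1) => x i.castSucc, eq_comm]
  rw [h, span_pair_eq_adjoin (hx 0)]
  exact finrank_adjoin_zero hx hp

theorem computesSpanDim_three (n : ℕ) :
    ComputesSpanDim.{u} (![0, Pi.single 0 1, Pi.single 1 1] : Fin 3 → Fin (n + 2) → Fin 2)
      fun p => (if p 0 then 1 else 2) + if p 1 then 0 else 1 := by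
  intro E Ω _ _ _ x hx p hp
  have h : (Set.range fun j => ∏ i, x i.castSucc ^
      ((![0, Pi.single 0 1, Pi.single 1 1] : Fin 3 → Fin (n + 2) → Fin 2) j i : ℕ)) =
      {1, x 0} ∪ {x 1} := by
    ext y
    simp [Fin.exists_fin_succ, prod_pow_single fun i : Fin (n + 2) => x i.castSucc, eq_comm]
    tauto
  have hI : Set.Iio (1 : Fin (n + 3)) = {0} := by
    ext i
    simp [Fin.lt_one_iff]
  have hp1 := hp 1
  rw [hI, Set.image_singleton] at hp1
  -- The span is `E(x 0) + x 1 · E`, again a field plus a multiple of a subspace of it.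
  have hx1 : ({x 1} : Set Ω) = LinearMap.mulLeft E (x 1) '' {1} := by simp
  have hfd : FiniteDimensional E (adjoin E {x 0}) := by
    have := finiteDimensional_adjoin_of_sq_mem x hx {0}
    rwa [Set.image_singleton] at this
  rw [h, Submodule.span_union, span_pair_eq_adjoin (hx 0), hx1, ← Submodule.map_span,
    finrank_sup_map_mulLeft, finrank_adjoin_zero hx hp, finrank_span_singleton one_ne_zero]
  · simp only [← hp1]
  · rw [Submodule.span_le, Set.singleton_subset_iff]
    exact (adjoin E {x 0}).one_mem

variable {F : Type u} [Field F] [CharP F 2] {V : Type v} [AddCommGroup V] [Module F V]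
  [FiniteDimensional F V] {φ : QuadraticForm F V}

theorem fullSplittingPattern_one (hφ : φ.Anisotropic) (hts : IsTotallySingular φ) {n : ℕ}
    {a : Fin n → F} {d : F}
    (h : Similar φ (QuadraticMap.prod (pfister a) (d • diag ![(1 : F)])))
    (hmax : ∀ p : Fin (n + 1) → Bool,
      patternDim (fun _ => 1) p = Module.finrank F V → ∀ i, p i = false) :
    fullSplittingPattern φ = Set.range (patternDim (n := n) fun _ => 1) := by
  refine fullSplittingPattern_eq_range (computesSpanDim_one n) hφ hts (Fin.snoc a d) ?_ hmax
  convert h using 4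
  · simp
  · simp
  · ext j
    rw [Subsingleton.elim j 0]
    simp

theorem fullSplittingPattern_two (hφ : φ.Anisotropic) (hts : IsTotallySingular φ) {n : ℕ}
    {a : Fin (n + 1) → F} {d : F}
    (h : Similar φ (QuadraticMap.prod (pfister a) (d • diag ![1, a 0])))
    (hmax : ∀ p : Fin (n + 2) → Bool, patternDim (fun p => if p 0 then 1 else 2) p =
      Module.finrank F V → ∀ i, p i = false) :
    fullSplittingPattern φ =
      Set.range (patternDim (n := n + 1) fun p => if p 0 then 1 else 2) := by
  refine fullSplittingPattern_eq_range (computesSpanDim_two n) hφ hts (Fin.snoc a d) ?_ hmax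
  convert h using 4
  · simp
  · simp
  · ext j
    simp only [Fin.snoc_castSucc]
    refine Fin.cases ?_ (fun j => ?_) j
    · simp
    · rw [Subsingleton.elim j 0]
      exact prod_pow_single a 0

theorem fullSplittingPattern_three (hφ : φ.Anisotropic) (hts : IsTotallySingular φ) {n : ℕ}
    {a : Fin (n + 2) → F} {d : F}
    (h : Similar φ (QuadraticMap.prod (pfister a) (d • diag ![1, a 0, a 1])))
    (hmax : ∀ p : Fin (n + 3) → Bool,
      patternDim (fun p => (if p 0 then 1 else 2) + if p 1 then 0 else 1) p =
      Module.finrank F V → ∀ i, p i = false) :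
    fullSplittingPattern φ = Set.range
      (patternDim (n := n + 2) fun p => (if p 0 then 1 else 2) + if p 1 then 0 else 1) := by
  refine fullSplittingPattern_eq_range (computesSpanDim_three n) hφ hts (Fin.snoc a d) ?_ hmax
  convert h using 4
  · simp
  · simp
  · ext j
    simp only [Fin.snoc_castSucc]
    refine Fin.cases ?_ (fun j => Fin.cases ?_ (fun j => ?_) j) j
    · simp
    · exact prod_pow_single a 0
    · rw [Subsingleton.elim j 0]
      exact prod_pow_single a 1

/-- The strict bounds on `m` place `N` strictly between `2 ^ n` and `2 ^ (n + 1)`, so the dimension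
alone fixes those of `π` and `σ`. -/
theorem eq_of_eq_two_pow_add {N n m : ℕ} (hN : N = 2 ^ n + m) (hm : 0 < m) (hmn : m < 2 ^ n)
    (k l : ℕ) (h : N = 2 ^ k + l) (hl : l ≤ 2 ^ k) : k = n ∧ l = m := by
  have hk : k = n := by
    rcases lt_trichotomy k n with hlt | heq | hgt
    · have := Nat.pow_le_pow_right two_pos (Nat.succ_le_of_lt hlt)
      rw [pow_succ] at this
      omega
    · exact heq
    · have := Nat.pow_le_pow_right two_pos (Nat.succ_le_of_lt hgt)
      rw [pow_succ] at this
      omega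
  subst hk
  exact ⟨rfl, by omega⟩

end SmallSubforms

end TSQF

/-! ### The seven dimensions -/

theorem mainTheorem11 {F : Type u} [Field F] [CharP F 2]
    {V : Type v} [AddCommGroup V] [Module F V] [FiniteDimensional F V]
    (φ : QuadraticForm F V) (hφ : φ.Anisotropic)
    (hs : TSQF.IsSpecialQuasiPfisterNeighbor φ) :
    (Module.finrank F V = 3 →
      (∃ a d : F, a ≠ 0 ∧ d ≠ 0 ∧
        TSQF.Similar φ (QuadraticMap.prod (TSQF.pfister ![a]) (d • TSQF.diag ![(1 : F)]))) ∧
      TSQF.fullSplittingPattern φ = {1, 2, 3}) ∧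
    (Module.finrank F V = 5 →
      (∃ a b d : F, a ≠ 0 ∧ b ≠ 0 ∧ d ≠ 0 ∧
        TSQF.Similar φ (QuadraticMap.prod (TSQF.pfister ![a, b]) (d • TSQF.diag ![(1 : F)]))) ∧
      TSQF.fullSplittingPattern φ = {1, 2, 3, 4, 5}) ∧
    (Module.finrank F V = 6 →
      (∃ a b d : F, a ≠ 0 ∧ b ≠ 0 ∧ d ≠ 0 ∧
        TSQF.Similar φ (QuadraticMap.prod (TSQF.pfister ![a, b]) (d • TSQF.diag ![1, a]))) ∧
      TSQF.fullSplittingPattern φ = {1, 2, 3, 4, 6}) ∧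
    (Module.finrank F V = 7 →
      (∃ a b d : F, a ≠ 0 ∧ b ≠ 0 ∧ d ≠ 0 ∧
        TSQF.Similar φ (QuadraticMap.prod (TSQF.pfister ![a, b]) (d • TSQF.diag ![1, a, b]))) ∧
      TSQF.fullSplittingPattern φ = {1, 2, 4, 7}) ∧
    (Module.finrank F V = 9 →
      (∃ a b c d : F, a ≠ 0 ∧ b ≠ 0 ∧ c ≠ 0 ∧ d ≠ 0 ∧
        TSQF.Similar φ (QuadraticMap.prod (TSQF.pfister ![a, b, c]) (d • TSQF.diag ![(1 : F)]))) ∧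
      TSQF.fullSplittingPattern φ = {1, 2, 3, 4, 5, 8, 9}) ∧
    (Module.finrank F V = 10 →
      (∃ a b c d : F, a ≠ 0 ∧ b ≠ 0 ∧ c ≠ 0 ∧ d ≠ 0 ∧
        TSQF.Similar φ (QuadraticMap.prod (TSQF.pfister ![a, b, c]) (d • TSQF.diag ![1, a]))) ∧
      TSQF.fullSplittingPattern φ = {1, 2, 3, 4, 5, 6, 8, 10}) ∧
    (Module.finrank F V = 11 →
      (∃ a b c d : F, a ≠ 0 ∧ b ≠ 0 ∧ c ≠ 0 ∧ d ≠ 0 ∧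
        TSQF.Similar φ (QuadraticMap.prod (TSQF.pfister ![a, b, c]) (d • TSQF.diag ![1, a, b]))) ∧
      TSQF.fullSplittingPattern φ = {1, 2, 3, 4, 6, 7, 8, 11}) := by
  have mem_range : ∀ {n : ℕ} (σ : (Fin (n + 1) → Bool) → ℕ) (S : Set ℕ),
      (∀ p, TSQF.patternDim σ p ∈ S) → (∀ k ∈ S, ∃ p, TSQF.patternDim σ p = k) →
      Set.range (TSQF.patternDim σ) = S := fun σ S h1 h2 =>
    Set.Subset.antisymm (Set.range_subset_iff.2 h1) h2
  refine ⟨fun h => ?_, fun h => ?_, fun h => ?_, fun h => ?_, fun h => ?_, fun h => ?_, fun h => ?_⟩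
  · obtain ⟨a, d, hsim⟩ := hs.exists_similar_one hφ 1
      (TSQF.eq_of_eq_two_pow_add h (by norm_num) (by norm_num))
    have h0 := TSQF.coeff_ne_zero_of_similar hφ hsim
    refine ⟨⟨a 0, d, h0.1 0, h0.2, ?_⟩, ?_⟩
    · rwa [← FinVec.etaExpand_eq a] at hsim
    -- Here and in the other cases, `hmax` and both inclusions are checked over all Boolean vectors
    -- `p`, at most 16 of them.
    · rw [TSQF.fullSplittingPattern_one hφ hs.1 hsim (by rw [h]; decide)]
      refine mem_range _ _ (by simp only [Set.mem_insert_iff, Set.mem_singleton_iff]; decide) ?_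
      simp only [Set.mem_insert_iff, Set.mem_singleton_iff, forall_eq_or_imp, forall_eq]
      decide
  · obtain ⟨a, d, hsim⟩ := hs.exists_similar_one hφ 2
      (TSQF.eq_of_eq_two_pow_add h (by norm_num) (by norm_num))
    have h0 := TSQF.coeff_ne_zero_of_similar hφ hsim
    refine ⟨⟨a 0, a 1, d, h0.1 0, h0.1 1, h0.2, ?_⟩, ?_⟩
    · rwa [← FinVec.etaExpand_eq a] at hsim
    · rw [TSQF.fullSplittingPattern_one hφ hs.1 hsim (by rw [h]; decide)]
      refine mem_range _ _ (by simp only [Set.mem_insert_iff, Set.mem_singleton_iff]; decide) ?_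
      simp only [Set.mem_insert_iff, Set.mem_singleton_iff, forall_eq_or_imp, forall_eq]
      decide
  · obtain ⟨a, d, hsim⟩ := hs.exists_similar_two hφ 1
      (TSQF.eq_of_eq_two_pow_add h (by norm_num) (by norm_num))
    have h0 := TSQF.coeff_ne_zero_of_similar hφ hsim
    refine ⟨⟨a 0, a 1, d, h0.1 0, h0.1 1, h0.2, ?_⟩, ?_⟩
    · rwa [← FinVec.etaExpand_eq a] at hsim
    · rw [TSQF.fullSplittingPattern_two hφ hs.1 hsim (by rw [h]; decide)]
      refine mem_range _ _ (by simp only [Set.mem_insert_iff, Set.mem_singleton_iff]; decide) ?_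
      simp only [Set.mem_insert_iff, Set.mem_singleton_iff, forall_eq_or_imp, forall_eq]
      decide
  · obtain ⟨a, d, hsim⟩ := hs.exists_similar_three hφ 0
      (TSQF.eq_of_eq_two_pow_add h (by norm_num) (by norm_num))
    have h0 := TSQF.coeff_ne_zero_of_similar hφ hsim
    refine ⟨⟨a 0, a 1, d, h0.1 0, h0.1 1, h0.2, ?_⟩, ?_⟩
    · rwa [← FinVec.etaExpand_eq a] at hsim
    · rw [TSQF.fullSplittingPattern_three hφ hs.1 hsim (by rw [h]; decide)]
      refine mem_range _ _ (by simp only [Set.mem_insert_iff, Set.mem_singleton_iff]; decide) ?_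
      simp only [Set.mem_insert_iff, Set.mem_singleton_iff, forall_eq_or_imp, forall_eq]
      decide
  · obtain ⟨a, d, hsim⟩ := hs.exists_similar_one hφ 3
      (TSQF.eq_of_eq_two_pow_add h (by norm_num) (by norm_num))
    have h0 := TSQF.coeff_ne_zero_of_similar hφ hsim
    refine ⟨⟨a 0, a 1, a 2, d, h0.1 0, h0.1 1, h0.1 2, h0.2, ?_⟩, ?_⟩
    · rwa [← FinVec.etaExpand_eq a] at hsim
    · rw [TSQF.fullSplittingPattern_one hφ hs.1 hsim (by rw [h]; decide)]
      refine mem_range _ _ (by simp only [Set.mem_insert_iff, Set.mem_singleton_iff]; decide) ?_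
      simp only [Set.mem_insert_iff, Set.mem_singleton_iff, forall_eq_or_imp, forall_eq]
      decide
  · obtain ⟨a, d, hsim⟩ := hs.exists_similar_two hφ 2
      (TSQF.eq_of_eq_two_pow_add h (by norm_num) (by norm_num))
    have h0 := TSQF.coeff_ne_zero_of_similar hφ hsim
    refine ⟨⟨a 0, a 1, a 2, d, h0.1 0, h0.1 1, h0.1 2, h0.2, ?_⟩, ?_⟩
    · rwa [← FinVec.etaExpand_eq a] at hsim
    · rw [TSQF.fullSplittingPattern_two hφ hs.1 hsim (by rw [h]; decide)]
      refine mem_range _ _ (by simp only [Set.mem_insert_iff, Set.mem_singleton_iff]; decide) ?_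
      simp only [Set.mem_insert_iff, Set.mem_singleton_iff, forall_eq_or_imp, forall_eq]
      decide
  · obtain ⟨a, d, hsim⟩ := hs.exists_similar_three hφ 1
      (TSQF.eq_of_eq_two_pow_add h (by norm_num) (by norm_num))
    have h0 := TSQF.coeff_ne_zero_of_similar hφ hsim
    refine ⟨⟨a 0, a 1, a 2, d, h0.1 0, h0.1 1, h0.1 2, h0.2, ?_⟩, ?_⟩
    · rwa [← FinVec.etaExpand_eq a] at hsim
    · rw [TSQF.fullSplittingPattern_three hφ hs.1 hsim (by rw [h]; decide)]
      refine mem_range _ _ (by simp only [Set.mem_insert_iff, Set.mem_singleton_iff]; decide) ?_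
      simp only [Set.mem_insert_iff, Set.mem_singleton_iff, forall_eq_or_imp, forall_eq]
      decide
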